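/- Let $A$ be a finite-dimensional Hopf $^*$-algebra over $\mathbb{C}$, i.e. a finite-dimensional unital complex $^*$-algebra with a Hopf algebra structure (comultiplication $\Delta$, antipode $S$) such that $\Delta(a^*)=\Delta(a)^*$ for all $a\in A$. Let $\varphi$ be a positive left integral on $A$: a non-zero linear functional $\varphi:A\to\mathbb{C}$ with $(\iota\otimes\varphi)\Delta(a)=\varphi(a)1$ and $\varphi(a^*a)\ge 0$ for all $a\in A$. Let $B=\{\varphi(\,\cdot\,a): a\in A\}$ be the dual of $A$, and define linear operators on $A$ by $$\pi(a)x=ax,\qquad \lambda(b)x=\langle S^{-1}(x_{(1)}),b\rangle\,x_{(2)}\qquad (a,x\in A,\ b\in B),$$ where $\Delta(x)=x_{(1)}\otimes x_{(2)}$ in Sweedler notation and $\langle a,b\rangle=b(a)$. Let $C$ be the Heisenberg algebra, i.e. the algebra of operators on $A$ generated by all $\pi(a)$ and all $\lambda(b)$, and let $\mathrm{tr}$ denote the trace on $C$, i.e. the usual trace of linear operators on the finite-dimensional space $A$. Then there is a scalar $k\in\mathbb{C}$ such that $$\varphi(a)=k\,\mathrm{tr}(\pi(a))\qquad\text{for all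 } a\in A.$$ -/

import Mathlib

open scoped TensorProduct ComplexOrder

noncomputable section

/-- A Hopf `*`-algebra over `ℂ`: a Hopf algebra on a unital complex `*`-algebra (given by the
instances `HopfAlgebra`, `StarRing`, `StarModule`) whose comultiplication `Δ : A → A ⊗ A` is a
`*`-homomorphism, where `(a ⊗ b)* = a* ⊗ b*`. -/
class HopfStarAlgebra (A : Type*) [Ring A] [HopfAlgebra ℂ A] [StarRing A] [StarModule ℂ A] :
    Prop where
  comul_star : ∀ a : A,
    Coalgebra.comul (R := ℂ) (star a) = star (Coalgebra.comul (R := ℂ) a)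

namespace HopfStarAlgebra

variable {A : Type*} [Ring A] [HopfAlgebra ℂ A] [StarRing A] [StarModule ℂ A]

section AntipodeInverse

variable [HopfStarAlgebra A]

/-- If `Δ(a) = ∑ aᵢ ⊗ bᵢ` then `Δ(a*) = ∑ aᵢ* ⊗ bᵢ*`. -/
def starRepr {ι : Type*} {a : A} (r : Coalgebra.Repr ℂ a ι) : Coalgebra.Repr ℂ (star a) ι where
  index := r.index
  left i := star (r.left i)
  right i := star (r.right i)
  eq := by
    rw [comul_star, ← r.eq, star_sum]
    simp

theorem counit_star (a : A) :
    Coalgebra.counit (R := ℂ) (star a) = star (Coalgebra.counit (R := ℂ) a) := by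
  have r := Coalgebra.Repr.arbitrary ℂ (star a)
  have h1 := congrArg star (congrArg (Coalgebra.counit (R := ℂ)) (congrArg star
    (Coalgebra.sum_counit_smul r)))
  have h2 : ∑ i ∈ r.index, Coalgebra.counit (R := ℂ) (star (r.right i)) • star (r.left i) = a := by
    have h := congrArg (TensorProduct.rid ℂ A) (Coalgebra.sum_tmul_counit_eq (starRepr r))
    simpa [starRepr] using h
  have h3 := congrArg (Coalgebra.counit (R := ℂ)) (congrArg star h2)
  simp only [star_star, star_sum, map_sum, star_smul, map_smul, smul_eq_mul, star_mul'] at h1 h3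
  rw [← h3, ← h1]
  exact Finset.sum_congr rfl fun i _ => mul_comm _ _

/-- `S(S(a*)*) = a`: applying `S` to `∑ a₍₂₎ S(a₍₁₎*)* = ε(a)1` shows that `a ↦ S(S(a*)*)` is a
convolution inverse of `S`. -/
theorem antipode_star_antipode_star (a : A) :
    HopfAlgebra.antipode ℂ (star (HopfAlgebra.antipode ℂ (star a))) = a := by
  let S' : A →ₗ[ℂ] A :=
    { toFun := fun x => HopfAlgebra.antipode ℂ (star (HopfAlgebra.antipode ℂ (star x)))
      map_add' := by simp
      map_smul' := by simp }
  have h : WithConv.toConv S' * WithConv.toConv (HopfAlgebra.antipode ℂ (A := A)) = 1 := by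
    ext x
    have r := Coalgebra.Repr.arbitrary ℂ x
    have h := HopfAlgebra.sum_antipode_mul_eq_algebraMap_counit (starRepr r)
    have h' := congrArg (HopfAlgebra.antipode ℂ (A := A)) (congrArg star h)
    rw [r.convMul_apply]
    simp only [starRepr, star_sum, star_mul, star_star, map_sum,
      HopfAlgebra.antipode_mul_antidistrib, counit_star, Algebra.algebraMap_eq_smul_one,
      star_smul, star_one, map_smul, HopfAlgebra.antipode_one] at h'
    rw [LinearMap.convOne_apply, Algebra.algebraMap_eq_smul_one, ← h']
    rfl
  have h' := left_inv_eq_right_inv h (LinearMap.antipode_mul_id (R := ℂ) (C := A))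
  exact congrArg (fun f => f.ofConv a) h'

variable (A) in
/-- The antipode `S` of a Hopf `*`-algebra as a linear bijection; `S⁻¹(a) = S(a*)*`. -/
def antipodeEquiv : A ≃ₗ[ℂ] A where
  __ := HopfAlgebra.antipode ℂ (A := A)
  invFun a := star (HopfAlgebra.antipode ℂ (star a))
  left_inv a := by
    have h := congrArg star (antipode_star_antipode_star (star a))
    simpa using h
  right_inv a := antipode_star_antipode_star a

end AntipodeInverse

/-- A positive left integral: a non-zero linear functional `φ` with `(ι ⊗ φ)Δ(a) = φ(a)1` and
`φ(a*a) ≥ 0` for all `a` (in particular `φ(a*a)` is real). -/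
structure IsPositiveLeftIntegral (φ : A →ₗ[ℂ] ℂ) : Prop where
  ne_zero : φ ≠ 0
  left_invariant : ∀ a : A,
    TensorProduct.rid ℂ A (φ.lTensor A (Coalgebra.comul (R := ℂ) a)) = φ a • (1 : A)
  nonneg : ∀ a : A, 0 ≤ φ (star a * a)

/-- The space `B` of functionals of the form `x ↦ φ(xa)`, `a ∈ A`, i.e. the dual of `A`. -/
def dualSpace (φ : A →ₗ[ℂ] ℂ) : Set (A →ₗ[ℂ] ℂ) :=
  Set.range fun a : A => φ ∘ₗ LinearMap.mulRight ℂ a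

variable (A) in
/-- The multiplication operators `π(a)x = ax`. -/
def mulOp : A →ₐ[ℂ] Module.End ℂ A := Algebra.lmul ℂ A

/-- The convolution operators `λ(b)x = ⟨S⁻¹(x₍₁₎), b⟩ x₍₂₎`. -/
def convOp [HopfStarAlgebra A] (b : A →ₗ[ℂ] ℂ) : Module.End ℂ A :=
  (TensorProduct.lid ℂ A).toLinearMap ∘ₗ
    TensorProduct.map (b ∘ₗ (antipodeEquiv A).symm.toLinearMap) LinearMap.id ∘ₗ
    Coalgebra.comul (R := ℂ)

/-- The Heisenberg algebra `C`: the algebra of operators on `A` generated by all `π(a)`, `a ∈ A`,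
and all `λ(b)`, `b ∈ B`. -/
def heisenbergAlgebra [HopfStarAlgebra A] (φ : A →ₗ[ℂ] ℂ) : Subalgebra ℂ (Module.End ℂ A) :=
  Algebra.adjoin ℂ (Set.range (mulOp A) ∪ convOp '' dualSpace φ)

/-- The embedding `π : A → C`. -/
def heisenbergPi [HopfStarAlgebra A] (φ : A →ₗ[ℂ] ℂ) : A →ₐ[ℂ] heisenbergAlgebra φ :=
  (mulOp A).codRestrict (heisenbergAlgebra φ) fun a =>
    Algebra.subset_adjoin (Or.inl ⟨a, rfl⟩)

/-- The trace on the Heisenberg algebra `C`: the usual trace of operators on the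
(finite-dimensional) space `A`. -/
def heisenbergTrace [HopfStarAlgebra A] (φ : A →ₗ[ℂ] ℂ) : heisenbergAlgebra φ →ₗ[ℂ] ℂ :=
  LinearMap.trace ℂ A ∘ₗ (heisenbergAlgebra φ).val.toLinearMap

end HopfStarAlgebra

end

/-! Write τ for the regular character, n = dim A and h = τ/n. The plan is to show that h is a
right-invariant state; evaluating h ⊗ φ on Δ(a) in two ways then gives φ(a) = φ(1)h(a). A non-zero
left integral is faithful (`eq_zero_of_forall_integral_mul_eq_zero`), so φ(x*y) is an inner product,
and a trace in an orthonormal basis shows that τ is positive definite. The invertible `twist`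
intertwines left multiplication by Δ(a) with a ⊗ 1, so (τ ⊗ τ)Δ = nτ and h is a convolution
idempotent. For b = (h ⊗ ι)Δ(a), idempotence makes the h ⊗ h norm of Δ(b) - 1 ⊗ b vanish. Hence Δ(b)
= 1 ⊗ b and b is scalar (`sliceLeft_comul_eq_smul_one`). -/

open TensorProduct

namespace HopfStarAlgebra

section Functionals

variable {A : Type*} [Ring A] [Algebra ℂ A]

/-- `a ↦ tr(L_a)`, the character of the left regular representation. -/
noncomputable def regularTrace (A : Type*) [Ring A] [Algebra ℂ A] : A →ₗ[ℂ] ℂ :=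
  LinearMap.trace ℂ A ∘ₗ LinearMap.mul ℂ A

/-- The functional `h ⊗ h` on `A ⊗ A`. -/
noncomputable def tensorSquare (h : A →ₗ[ℂ] ℂ) : A ⊗[ℂ] A →ₗ[ℂ] ℂ :=
  LinearMap.mul' ℂ ℂ ∘ₗ TensorProduct.map h h

@[simp]
theorem tensorSquare_tmul (h : A →ₗ[ℂ] ℂ) (x y : A) : tensorSquare h (x ⊗ₜ y) = h x * h y := rfl

end Functionals

/-! ### Positive functionals and positivity of the regular character. -/

section Sesquilinear

variable {A : Type*} [Ring A] [Algebra ℂ A] [StarRing A] [StarModule ℂ A]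

/-- A functional that is nonnegative on all `a* a` is hermitian on products. -/
theorem conj_apply_star_mul {h : A →ₗ[ℂ] ℂ} (hpos : ∀ a, 0 ≤ h (star a * a)) (x y : A) :
    (starRingEnd ℂ) (h (star y * x)) = h (star x * y) := by
  have im0 (a : A) : (h (star a * a)).im = 0 := (Complex.nonneg_iff.mp (hpos a)).2.symm
  -- Polarization: x + y controls the imaginary parts and x + iy the real parts.
  have h1 := im0 (x + y)
  have h2 := im0 (x + Complex.I • y)
  have hx := im0 x
  have hy := im0 y
  simp only [star_add, star_smul, add_mul, mul_add, map_add, smul_mul_assoc, mul_smul_comm,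
    map_smul, smul_eq_mul, Complex.add_im, Complex.mul_im, Complex.star_def, Complex.conj_I,
    Complex.I_re, Complex.I_im, Complex.neg_re, Complex.neg_im, Complex.mul_re] at h1 h2
  apply Complex.ext
  · simp only [Complex.conj_re]; linarith
  · simp only [Complex.conj_im]; linarith

/-- The sesquilinear form `h(x* y)` of a positive functional. -/
@[reducible]
def preInnerCore (h : A →ₗ[ℂ] ℂ) (hpos : ∀ a, 0 ≤ h (star a * a)) :
    PreInnerProductSpace.Core ℂ A where
  inner x y := h (star x * y)
  conj_inner_symm x y := conj_apply_star_mul hpos x y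
  re_inner_nonneg x := (Complex.nonneg_iff.mp (hpos x)).1
  add_left x y z := by simp [add_mul]
  smul_left x y r := by simp

/-- The inner product `h(x* y)` of a positive definite functional. -/
@[reducible]
def innerCore (h : A →ₗ[ℂ] ℂ) (hpos : ∀ a, 0 ≤ h (star a * a))
    (hdef : ∀ a, h (star a * a) = 0 → a = 0) : InnerProductSpace.Core ℂ A where
  __ := preInnerCore h hpos
  definite := hdef

/-- Cauchy–Schwarz for the possibly degenerate form h(x*y). -/
theorem apply_star_mul_eq_zero {h : A →ₗ[ℂ] ℂ} (hpos : ∀ a, 0 ≤ h (star a * a)) {a : A}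
    (ha : h (star a * a) = 0) (x : A) : h (star x * a) = 0 := by
  let := preInnerCore h hpos
  have key : ‖h (star x * a)‖ * ‖h (star a * x)‖ ≤
      RCLike.re (h (star x * x)) * RCLike.re (h (star a * a)) :=
    InnerProductSpace.Core.inner_mul_inner_self_le (𝕜 := ℂ) x a
  rw [← conj_apply_star_mul hpos a x, ha, RCLike.norm_conj] at key
  simp only [map_zero, mul_zero] at key
  exact norm_eq_zero.mp (mul_self_eq_zero.mp (le_antisymm key (mul_self_nonneg _)))

theorem exists_orthonormal_basis [FiniteDimensional ℂ A] {h : A →ₗ[ℂ] ℂ}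
    (hpos : ∀ a, 0 ≤ h (star a * a)) (hdef : ∀ a, h (star a * a) = 0 → a = 0) :
    ∃ e : Module.Basis (Fin (Module.finrank ℂ A)) ℂ A,
      ∀ i x, e.repr x i = h (star (e i) * x) := by
  let := innerCore h hpos hdef
  let : NormedAddCommGroup A := InnerProductSpace.Core.toNormedAddCommGroup (𝕜 := ℂ)
  let : InnerProductSpace ℂ A := InnerProductSpace.ofCore _
  refine ⟨(stdOrthonormalBasis ℂ A).toBasis, fun i x => ?_⟩
  rw [OrthonormalBasis.coe_toBasis_repr_apply, OrthonormalBasis.repr_apply_apply,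
    OrthonormalBasis.coe_toBasis]
  rfl

omit [StarModule ℂ A] in
theorem regularTrace_star_mul_self [FiniteDimensional ℂ A] {h : A →ₗ[ℂ] ℂ}
    {e : Module.Basis (Fin (Module.finrank ℂ A)) ℂ A}
    (he : ∀ i x, e.repr x i = h (star (e i) * x)) (a : A) :
    regularTrace A (star a * a) = ∑ i, h (star (a * e i) * (a * e i)) := by
  simp [regularTrace, LinearMap.trace_eq_matrix_trace ℂ e, Matrix.trace, LinearMap.toMatrix_apply,
    he, mul_assoc]

theorem regularTrace_nonneg [FiniteDimensional ℂ A] {h : A →ₗ[ℂ] ℂ}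
    (hpos : ∀ a, 0 ≤ h (star a * a)) (hdef : ∀ a, h (star a * a) = 0 → a = 0) (a : A) :
    0 ≤ regularTrace A (star a * a) := by
  obtain ⟨e, he⟩ := exists_orthonormal_basis hpos hdef
  rw [regularTrace_star_mul_self he]
  exact Finset.sum_nonneg fun i _ => hpos _

theorem eq_zero_of_regularTrace_eq_zero [FiniteDimensional ℂ A] {h : A →ₗ[ℂ] ℂ}
    (hpos : ∀ a, 0 ≤ h (star a * a)) (hdef : ∀ a, h (star a * a) = 0 → a = 0) (a : A)
    (ha : regularTrace A (star a * a) = 0) : a = 0 := by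
  obtain ⟨e, he⟩ := exists_orthonormal_basis hpos hdef
  rw [regularTrace_star_mul_self he, Finset.sum_eq_zero_iff_of_nonneg fun i _ => hpos _] at ha
  have h0 : LinearMap.mulLeft ℂ a = 0 := e.ext fun i => by
    simpa using hdef _ (ha i (Finset.mem_univ i))
  simpa using LinearMap.congr_fun h0 1

/-- If `h` is positive definite then so is `h ⊗ h`. -/
theorem eq_zero_of_tensorSquare_eq_zero [FiniteDimensional ℂ A] {h : A →ₗ[ℂ] ℂ}
    (hpos : ∀ a, 0 ≤ h (star a * a)) (hdef : ∀ a, h (star a * a) = 0 → a = 0) (q : A ⊗[ℂ] A)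
    (hq : tensorSquare h (star q * q) = 0) : q = 0 := by
  obtain ⟨e, he⟩ := exists_orthonormal_basis hpos hdef
  -- With q = ∑ cᵢ ⊗ eᵢ and e orthonormal, the cross terms vanish.
  obtain ⟨c, rfl⟩ := TensorProduct.eq_repr_basis_right e q
  rw [Finsupp.sum_fintype _ _ (by simp)] at hq ⊢
  have h1 : tensorSquare h (star (∑ i, c i ⊗ₜ[ℂ] e i) * ∑ i, c i ⊗ₜ[ℂ] e i) =
      ∑ i, h (star (c i) * c i) := by
    simp only [star_sum, TensorProduct.star_tmul, Finset.sum_mul_sum,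
      Algebra.TensorProduct.tmul_mul_tmul, map_sum, tensorSquare_tmul, ← he,
      Module.Basis.repr_self]
    simp [Finsupp.single_apply]
  rw [h1, Finset.sum_eq_zero_iff_of_nonneg fun i _ => hpos _] at hq
  exact Finset.sum_eq_zero fun i hi => by rw [hdef _ (hq i hi), zero_tmul]

end Sesquilinear

/-! ### The twist, faithfulness of integrals, and slice maps. -/

section Hopf

variable {A : Type*} [Ring A] [HopfAlgebra ℂ A]

open Coalgebra HopfAlgebra

/-- The operator `x ⊗ y ↦ x₍₁₎ ⊗ f(x₍₂₎) y`. -/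
noncomputable def twist (f : A →ₗ[ℂ] A) : Module.End ℂ (A ⊗[ℂ] A) :=
  (LinearMap.mul' ℂ A ∘ₗ f.rTensor A).lTensor A ∘ₗ
    (TensorProduct.assoc ℂ A A A).toLinearMap ∘ₗ comul.rTensor A

theorem twist_tmul (f : A →ₗ[ℂ] A) (x y : A) :
    twist f (x ⊗ₜ y) = (LinearMap.mulRight ℂ y ∘ₗ f).lTensor A (comul x) := by
  simp only [twist, LinearMap.comp_apply, LinearMap.rTensor_tmul, LinearEquiv.coe_coe]
  induction comul (R := ℂ) x using TensorProduct.induction_on with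
  | zero => simp
  | tmul a b => simp
  | add u v hu hv => simp only [add_tmul, map_add, hu, hv]

/-- `twist` turns convolution into composition. -/
theorem twist_mul (f g : A →ₗ[ℂ] A) :
    twist f * twist g = twist (WithConv.toConv f * WithConv.toConv g).ofConv := by
  refine TensorProduct.ext' fun x y => ?_
  set k : A ⊗[ℂ] A →ₗ[ℂ] A :=
    LinearMap.mulRight ℂ y ∘ₗ LinearMap.mul' ℂ A ∘ₗ TensorProduct.map f g with hk
  have h1 : ∀ z : A ⊗[ℂ] A, twist f ((LinearMap.mulRight ℂ y ∘ₗ g).lTensor A z) =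
      k.lTensor A (TensorProduct.assoc ℂ A A A (comul.rTensor A z)) := fun z => by
    induction z using TensorProduct.induction_on with
    | zero => simp
    | add u v hu hv => simp only [map_add, hu, hv]
    | tmul a c =>
      simp only [LinearMap.lTensor_tmul, twist_tmul, LinearMap.rTensor_tmul]
      induction comul (R := ℂ) a using TensorProduct.induction_on with
      | zero => simp
      | tmul a b => simp [hk, mul_assoc]
      | add u v hu hv => simp only [add_tmul, map_add, hu, hv]
  rw [Module.End.mul_apply, twist_tmul, h1, coassoc_apply, twist_tmul]
  rw [← LinearMap.lTensor_comp_apply]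
  rfl

/-- The identity and S are convolution inverse, and `twist` sends the convolution unit to the
identity. -/
theorem twist_id_mul_twist_antipode :
    twist (LinearMap.id : A →ₗ[ℂ] A) * twist (antipode ℂ) = 1 := by
  rw [twist_mul, LinearMap.id_mul_antipode]
  refine TensorProduct.ext' fun x y => ?_
  have h := congrArg ((LinearMap.toSpanSingleton ℂ A y).lTensor A) (lTensor_counit_comul (R := ℂ) x)
  rw [← LinearMap.lTensor_comp_apply] at h
  rw [twist_tmul]
  convert h using 2
  · congr 1
    ext z
    simp [Algebra.algebraMap_eq_smul_one]
  · simp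

/-- Multiplicativity of Δ: Δ(a)Δ(x)(1 ⊗ y) = Δ(ax)(1 ⊗ y). -/
theorem comul_mul_twist_id (a : A) :
    LinearMap.mulLeft ℂ (comul (R := ℂ) a) * twist (LinearMap.id : A →ₗ[ℂ] A) =
      twist LinearMap.id * TensorProduct.map (LinearMap.mulLeft ℂ a) LinearMap.id := by
  refine TensorProduct.ext' fun x y => ?_
  have h1 (z : A ⊗[ℂ] A) : (LinearMap.mulRight ℂ y ∘ₗ LinearMap.id).lTensor A z = z * (1 ⊗ₜ y) := by
    induction z using TensorProduct.induction_on with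
    | zero => simp
    | tmul a b => simp
    | add u v hu hv => simp only [map_add, add_mul, hu, hv]
  simp only [Module.End.mul_apply, twist_tmul, h1, LinearMap.mulLeft_apply,
    TensorProduct.map_tmul, LinearMap.id_apply, Bialgebra.comul_mul, mul_assoc]

/-- The regular character is, up to the factor `dim A`, a convolution idempotent. -/
theorem tensorSquare_regularTrace_comul [FiniteDimensional ℂ A] (a : A) :
    LinearMap.mul' ℂ ℂ (TensorProduct.map (regularTrace A) (regularTrace A) (comul (R := ℂ) a)) =
      Module.finrank ℂ A * regularTrace A a := by
  have h1 (z : A ⊗[ℂ] A) : LinearMap.mul' ℂ ℂ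
      (TensorProduct.map (regularTrace A) (regularTrace A) z) =
        LinearMap.trace ℂ _ (LinearMap.mulLeft ℂ z) := by
    induction z using TensorProduct.induction_on with
    | zero => simp
    | tmul a b =>
      have : LinearMap.mulLeft ℂ (a ⊗ₜ[ℂ] b) =
          TensorProduct.map (LinearMap.mulLeft ℂ a) (LinearMap.mulLeft ℂ b) :=
        TensorProduct.ext' fun x y => by simp
      rw [this, LinearMap.trace_tensorProduct']
      rfl
    | add u v hu hv =>
      have : LinearMap.mulLeft ℂ (u + v) = LinearMap.mulLeft ℂ u + LinearMap.mulLeft ℂ v := by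
        ext; simp [add_mul]
      rw [map_add, map_add, hu, hv, this, map_add]
  -- In finite dimension a one-sided inverse is two-sided.
  have h2 : twist (antipode ℂ) * twist (LinearMap.id : A →ₗ[ℂ] A) = 1 :=
    mul_eq_one_comm.mp twist_id_mul_twist_antipode
  rw [h1, ← mul_one (LinearMap.mulLeft ℂ (comul (R := ℂ) a)), ← twist_id_mul_twist_antipode,
    ← mul_assoc, comul_mul_twist_id, mul_assoc, LinearMap.trace_mul_comm, mul_assoc, h2, mul_one,
    LinearMap.trace_tensorProduct', LinearMap.trace_id, mul_comm]
  rfl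

/-- `S(x₍₁₎)x₍₂₎ ⊗ x₍₃₎ = 1 ⊗ x`. -/
theorem sum_antipode_tmul_one_mul_comul {ι : Type*} {x : A} (r : Coalgebra.Repr ℂ x ι) :
    ∑ i ∈ r.index, (antipode ℂ (r.left i) ⊗ₜ[ℂ] (1 : A)) * comul (R := ℂ) (r.right i) =
      1 ⊗ₜ x := by
  set k : A ⊗[ℂ] A →ₗ[ℂ] A := LinearMap.mul' ℂ A ∘ₗ (antipode ℂ).rTensor A with hk
  have h1 (y z : A) : (antipode ℂ y ⊗ₜ[ℂ] (1 : A)) * comul (R := ℂ) z =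
      k.rTensor A ((TensorProduct.assoc ℂ A A A).symm (comul.lTensor A (y ⊗ₜ z))) := by
    rw [LinearMap.lTensor_tmul]
    induction comul (R := ℂ) z using TensorProduct.induction_on with
    | zero => simp
    | tmul a b => simp [hk]
    | add u v hu hv => simp only [mul_add, tmul_add, map_add, hu, hv]
  simp_rw [h1, ← map_sum, r.eq]
  rw [coassoc_symm_apply, ← LinearMap.rTensor_comp_apply]
  have h2 : k ∘ₗ comul = Algebra.linearMap ℂ A ∘ₗ counit := by
    ext z
    exact mul_antipode_rTensor_comul_apply z
  rw [h2, LinearMap.rTensor_comp_apply, rTensor_counit_comul]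
  simp

/-- The slice map `ι ⊗ φ`. -/
noncomputable def sliceRight (φ : A →ₗ[ℂ] ℂ) : A ⊗[ℂ] A →ₗ[ℂ] A :=
  (TensorProduct.rid ℂ A).toLinearMap ∘ₗ φ.lTensor A

@[simp]
theorem sliceRight_tmul (φ : A →ₗ[ℂ] ℂ) (x y : A) : sliceRight φ (x ⊗ₜ y) = φ y • x := by
  simp [sliceRight]

theorem sliceRight_tmul_one_mul (φ : A →ₗ[ℂ] ℂ) (x : A) (z : A ⊗[ℂ] A) :
    sliceRight φ ((x ⊗ₜ 1) * z) = x * sliceRight φ z := by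
  induction z using TensorProduct.induction_on with
  | zero => simp
  | tmul a b => simp
  | add u v hu hv => simp only [mul_add, map_add, hu, hv]

/-- Strong left invariance: `a₍₁₎ φ(x a₍₂₎) = S(x₍₁₎) φ(x₍₂₎ a)`. -/
theorem sliceRight_one_tmul_mul_comul {φ : A →ₗ[ℂ] ℂ}
    (hφ : ∀ a, sliceRight φ (comul a) = φ a • (1 : A)) (a : A) {ι : Type*} {x : A}
    (r : Coalgebra.Repr ℂ x ι) :
    sliceRight φ ((1 ⊗ₜ x) * comul a) =
      ∑ i ∈ r.index, φ (r.right i * a) • antipode ℂ (r.left i) := by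
  rw [← sum_antipode_tmul_one_mul_comul r, Finset.sum_mul, map_sum]
  refine Finset.sum_congr rfl fun i _ => ?_
  rw [mul_assoc, sliceRight_tmul_one_mul, ← Bialgebra.comul_mul, hφ, mul_smul_comm, mul_one]

/-- A non-zero left integral is faithful. -/
theorem eq_zero_of_forall_integral_mul_eq_zero [FiniteDimensional ℂ A] {φ : A →ₗ[ℂ] ℂ}
    (hφ : ∀ a, sliceRight φ (comul a) = φ a • (1 : A)) (hne : φ ≠ 0) {a : A}
    (ha : ∀ x, φ (x * a) = 0) : a = 0 := by
  let e := Module.finBasis ℂ A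
  -- The left ideal N = {b : φ(xb) = 0 for all x} satisfies Δ(N) ⊆ A ⊗ N, by strong left invariance.
  have key : ∀ b : A, (∀ x, φ (x * b) = 0) → ∃ n : Fin (Module.finrank ℂ A) → A,
      comul (R := ℂ) b = ∑ j, e j ⊗ₜ n j ∧ ∀ j x, φ (x * n j) = 0 := by
    intro b hb
    obtain ⟨n, hn⟩ := TensorProduct.eq_repr_basis_left e (comul (R := ℂ) b)
    rw [Finsupp.sum_fintype _ _ (by simp)] at hn
    refine ⟨n, hn.symm, fun j x => ?_⟩
    have h := sliceRight_one_tmul_mul_comul hφ b (Coalgebra.Repr.arbitrary ℂ x)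
    simp only [hb, zero_smul, Finset.sum_const_zero, ← hn, Finset.mul_sum, map_sum,
      Algebra.TensorProduct.tmul_mul_tmul, one_mul, sliceRight_tmul] at h
    exact Fintype.linearIndependent_iff.mp e.linearIndependent _ h j
  -- ε(b)1 = S(b₍₁₎)b₍₂₎ lies in N, so ε(b) ≠ 0 would force φ = 0.
  have counit_eq : ∀ b : A, (∀ x, φ (x * b) = 0) → counit (R := ℂ) b = 0 := by
    intro b hb
    obtain ⟨n, hn, hn0⟩ := key b hb
    by_contra hc
    refine hne (LinearMap.ext fun x => ?_)
    have h := mul_antipode_rTensor_comul_apply (R := ℂ) b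
    rw [hn] at h
    simp only [map_sum, LinearMap.rTensor_tmul, LinearMap.mul'_apply] at h
    have h' := congrArg (fun y => φ (x * y)) h
    simp only [Finset.mul_sum, map_sum, ← mul_assoc, hn0, Finset.sum_const_zero,
      Algebra.algebraMap_eq_smul_one, mul_smul_comm, mul_one, map_smul, smul_eq_mul] at h'
    exact (mul_eq_zero.mp h'.symm).resolve_left hc
  -- Now a = a₍₁₎ε(a₍₂₎) = 0, since ε vanishes on N.
  obtain ⟨n, hn, hn0⟩ := key a ha
  have h := lTensor_counit_comul (R := ℂ) a
  simp only [hn, map_sum, LinearMap.lTensor_tmul, counit_eq _ (hn0 _), tmul_zero,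
    Finset.sum_const_zero] at h
  simpa using (congrArg (TensorProduct.rid ℂ A) h).symm

/-- The slice map `h ⊗ ι`. -/
noncomputable def sliceLeft (h : A →ₗ[ℂ] ℂ) : A ⊗[ℂ] A →ₗ[ℂ] A :=
  (TensorProduct.lid ℂ A).toLinearMap ∘ₗ h.rTensor A

@[simp]
theorem sliceLeft_tmul (h : A →ₗ[ℂ] ℂ) (x y : A) : sliceLeft h (x ⊗ₜ y) = h x • y := by
  simp [sliceLeft]

theorem apply_sliceRight (h φ : A →ₗ[ℂ] ℂ) (z : A ⊗[ℂ] A) :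
    h (sliceRight φ z) = φ (sliceLeft h z) := by
  induction z using TensorProduct.induction_on with
  | zero => simp
  | tmul a b => simp [mul_comm]
  | add u v hu hv => simp only [map_add, hu, hv]

theorem sliceLeft_mul_one_tmul (h : A →ₗ[ℂ] ℂ) (z : A ⊗[ℂ] A) (y : A) :
    sliceLeft h (z * (1 ⊗ₜ y)) = sliceLeft h z * y := by
  induction z using TensorProduct.induction_on with
  | zero => simp
  | tmul a b => simp
  | add u v hu hv => simp only [add_mul, map_add, hu, hv]

theorem sliceLeft_one_tmul_mul (h : A →ₗ[ℂ] ℂ) (z : A ⊗[ℂ] A) (y : A) :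
    sliceLeft h ((1 ⊗ₜ y) * z) = y * sliceLeft h z := by
  induction z using TensorProduct.induction_on with
  | zero => simp
  | tmul a b => simp
  | add u v hu hv => simp only [mul_add, map_add, hu, hv]

theorem apply_sliceLeft (h : A →ₗ[ℂ] ℂ) (z : A ⊗[ℂ] A) :
    h (sliceLeft h z) = LinearMap.mul' ℂ ℂ (TensorProduct.map h h z) := by
  induction z using TensorProduct.induction_on with
  | zero => simp
  | tmul a b => simp
  | add u v hu hv => simp only [map_add, hu, hv]

/-- Slicing by a convolution idempotent is idempotent. -/
theorem sliceLeft_comul_sliceLeft_comul {h : A →ₗ[ℂ] ℂ}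
    (hidem : ∀ a, LinearMap.mul' ℂ ℂ (TensorProduct.map h h (comul (R := ℂ) a)) = h a) (a : A) :
    sliceLeft h (comul (R := ℂ) (sliceLeft h (comul (R := ℂ) a))) =
      sliceLeft h (comul (R := ℂ) a) := by
  set k : A ⊗[ℂ] A →ₗ[ℂ] ℂ := LinearMap.mul' ℂ ℂ ∘ₗ TensorProduct.map h h with hk
  have h1 (z : A ⊗[ℂ] A) : sliceLeft h (comul (R := ℂ) (sliceLeft h z)) =
      TensorProduct.lid ℂ A (k.rTensor A
        ((TensorProduct.assoc ℂ A A A).symm (comul.lTensor A z))) := by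
    induction z using TensorProduct.induction_on with
    | zero => simp
    | add u v hu hv => simp only [map_add, hu, hv]
    | tmul a b =>
      simp only [sliceLeft_tmul, map_smul, LinearMap.lTensor_tmul]
      induction comul (R := ℂ) b using TensorProduct.induction_on with
      | zero => simp
      | tmul c d => simp [hk, mul_smul]
      | add u v hu hv => simp only [tmul_add, smul_add, map_add, hu, hv]
  have h2 : k ∘ₗ comul = h := LinearMap.ext hidem
  rw [h1, coassoc_symm_apply, ← LinearMap.rTensor_comp_apply, h2]
  rfl

end Hopf

/-! ### Right invariance of positive definite idempotent states. -/

section HaarState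

variable {A : Type*} [Ring A] [HopfAlgebra ℂ A] [StarRing A] [StarModule ℂ A]

open Coalgebra

theorem sliceLeft_star {h : A →ₗ[ℂ] ℂ} (hpos : ∀ a, 0 ≤ h (star a * a)) (z : A ⊗[ℂ] A) :
    sliceLeft h (star z) = star (sliceLeft h z) := by
  have h1 (x : A) : h (star x) = star (h x) := by
    simpa using (conj_apply_star_mul hpos x 1).symm
  induction z using TensorProduct.induction_on with
  | zero => simp
  | tmul a b => simp [TensorProduct.star_tmul, h1]
  | add u v hu hv => simp only [star_add, map_add, hu, hv]

/-- A positive definite convolution idempotent functional with `h(1) = 1` is right invariant. -/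
theorem sliceLeft_comul_eq_smul_one [HopfStarAlgebra A] [FiniteDimensional ℂ A] {h : A →ₗ[ℂ] ℂ}
    (hpos : ∀ a, 0 ≤ h (star a * a)) (hdef : ∀ a, h (star a * a) = 0 → a = 0) (hone : h 1 = 1)
    (hidem : ∀ a, LinearMap.mul' ℂ ℂ (TensorProduct.map h h (comul (R := ℂ) a)) = h a) (a : A) :
    sliceLeft h (comul (R := ℂ) a) = h a • (1 : A) := by
  set b := sliceLeft h (comul (R := ℂ) a) with hb
  have hbb : sliceLeft h (comul (R := ℂ) b) = b := sliceLeft_comul_sliceLeft_comul hidem a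
  have hstar : sliceLeft h (star (comul (R := ℂ) b)) = star b := by rw [sliceLeft_star hpos, hbb]
  have hq : comul (R := ℂ) b - 1 ⊗ₜ b = 0 := by
    apply eq_zero_of_tensorSquare_eq_zero hpos hdef
    -- Under h ⊗ h each of the four terms becomes ±h(b*b), the first by idempotence.
    have h1 : star (comul (R := ℂ) b - 1 ⊗ₜ b) * (comul (R := ℂ) b - 1 ⊗ₜ b) =
        comul (R := ℂ) (star b * b) - star (comul (R := ℂ) b) * (1 ⊗ₜ b)
          - (1 ⊗ₜ star b) * comul (R := ℂ) b + 1 ⊗ₜ (star b * b) := by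
      rw [Bialgebra.comul_mul, comul_star, star_sub, TensorProduct.star_tmul, star_one, sub_mul,
        mul_sub, mul_sub, Algebra.TensorProduct.tmul_mul_tmul, one_mul]
      abel
    change LinearMap.mul' ℂ ℂ (TensorProduct.map h h _) = 0
    rw [← apply_sliceLeft, h1]
    simp only [map_add, map_sub, sliceLeft_mul_one_tmul, sliceLeft_one_tmul_mul, hbb, hstar,
      sliceLeft_tmul, hone, one_smul]
    rw [apply_sliceLeft, hidem]
    ring
  have h2 := congrArg (TensorProduct.rid ℂ A ∘ counit.lTensor A) (sub_eq_zero.mp hq)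
  simp only [Function.comp_apply, lTensor_counit_comul, LinearMap.lTensor_tmul,
    TensorProduct.rid_tmul, one_smul] at h2
  have h3 : h b = h a := by rw [hb, apply_sliceLeft, hidem]
  -- Applying ι ⊗ ε to Δ(b) = 1 ⊗ b gave b = ε(b)1.
  have h4 : h b = counit (R := ℂ) b := by rw [h2]; simp [hone]
  rw [h2, ← h4, h3]

end HaarState

end HopfStarAlgebra

open HopfStarAlgebra in
theorem proposition3p10 {A : Type*} [Ring A] [HopfAlgebra ℂ A] [StarRing A] [StarModule ℂ A]
    [HopfStarAlgebra A] [FiniteDimensional ℂ A] (φ : A →ₗ[ℂ] ℂ)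
    (hφ : HopfStarAlgebra.IsPositiveLeftIntegral φ) :
    ∃ k : ℂ, ∀ a : A,
      φ a = k * HopfStarAlgebra.heisenbergTrace φ (HopfStarAlgebra.heisenbergPi φ a) := by
  have hinv : ∀ a, sliceRight φ (Coalgebra.comul a) = φ a • (1 : A) := hφ.left_invariant
  -- By Cauchy–Schwarz a null vector a satisfies φ(xa) = 0 for all x, so faithfulness applies.
  have hdef : ∀ a, φ (star a * a) = 0 → a = 0 := fun a ha =>
    eq_zero_of_forall_integral_mul_eq_zero hinv hφ.ne_zero fun x => by
      simpa using apply_star_mul_eq_zero hφ.nonneg ha (star x)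
  set n : ℂ := (Module.finrank ℂ A : ℂ) with hn
  have htrace (a : A) : heisenbergTrace φ (heisenbergPi φ a) = regularTrace A a := rfl
  have hτone : regularTrace A 1 = n := by
    have : LinearMap.mul ℂ A 1 = LinearMap.id := by ext; simp
    rw [regularTrace, LinearMap.comp_apply, this, LinearMap.trace_id]
  have hn0 : n ≠ 0 := by
    have : Nontrivial A := by
      by_contra hA
      rw [not_nontrivial_iff_subsingleton] at hA
      exact hφ.ne_zero (LinearMap.ext fun x => by rw [Subsingleton.elim x 0]; simp)
    exact Nat.cast_ne_zero.mpr Module.finrank_pos.ne'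
  have hright := sliceLeft_comul_eq_smul_one (h := n⁻¹ • regularTrace A)
    (fun a => by
      have hinv0 : 0 ≤ n⁻¹ := by
        rw [hn, ← Complex.ofReal_natCast, ← Complex.ofReal_inv]
        exact Complex.zero_le_real.mpr (by positivity)
      exact mul_nonneg hinv0 (regularTrace_nonneg hφ.nonneg hdef a))
    (fun a ha => eq_zero_of_regularTrace_eq_zero hφ.nonneg hdef a
      ((mul_eq_zero.mp ha).resolve_left (inv_ne_zero hn0)))
    (by simp [hτone, hn0])
    (fun a => by
      rw [TensorProduct.map_smul_left, TensorProduct.map_smul_right, LinearMap.smul_apply,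
        LinearMap.smul_apply, map_smul, map_smul, tensorSquare_regularTrace_comul, ← hn,
        LinearMap.smul_apply, smul_eq_mul, smul_eq_mul, inv_mul_cancel_left₀ hn0, smul_eq_mul])
  refine ⟨φ 1 * n⁻¹, fun a => ?_⟩
  -- Left invariance of φ turns (h ⊗ φ)Δ(a) into φ(a); right invariance of h turns it into φ(1)h(a).
  have h := apply_sliceRight (n⁻¹ • regularTrace A) φ (Coalgebra.comul a)
  rw [hinv, hright] at h
  simp only [map_smul, LinearMap.smul_apply, hτone, smul_eq_mul, inv_mul_cancel₀ hn0,
    mul_one] at h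
  rw [h, htrace]
  ring
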